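/- Fix a field $k$. A simplicial complex $\Delta$ is a family of subsets (faces) of a finite vertex set $V$ that is closed under taking subsets; its facets are its inclusion-maximal faces, and its dimension is the maximum of $|F|-1$ over its faces $F$. For a facet $F$ of $\Delta$, let $\Delta_F$ be the subcomplex whose facets are the facets of $\Delta$ other than $F$ (if $F$ is the only facet, $\Delta_F$ is the void complex, which has no faces). The Stanley–Reisner ring of $\Delta$ is $k[\Delta]=k[x_v : v\in V]/\left(\prod_{v\in F}x_v : F\subseteq V,\ F\notin\Delta\right)$, and $\operatorname{depth}\Delta$ is the depth of $k[\Delta]$ with respect to the ideal $(x_v : v\in V)$. A complex $\Delta$ of dimension $d-1$ is Cohen–Macaulay (CM) if $\operatorname{depth}\Delta=d$; the void complex, for which $k[\Delta]=0$, also counts as CM. The complex $\Delta$ is minimal CM if $\Delta$ is CM and $\Delta_F$ is not CM for any facet $F$ of $\Delta$; it is strongly CM if $\Delta$ is CM and $\Delta_F$ is CM for every facet $F$ of $\Delta$. Proposition. Let $d\ge 0$ and let $\Delta$ and $\Gamma$ be simplicial complexes on a common finite vertex set. If $\Delta$ and $\Gamma$ are minimal CM of dimension $d-1$ and $\Delta\cap\Gamma$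 is strongly CM of dimension $d-1$, then $\Delta\cup\Gamma$ is minimal CM. -/

import Mathlib

namespace MinimalCM

/-- A (finite, abstract) simplicial complex with vertices among the elements of `V`: a family of
finite subsets of `V` (the faces) that is closed under taking subsets. The empty set is a face of
every complex except the void complex `⊥`, which has no face at all; the complex whose only face
is the empty set is a different complex. The union and the intersection of two complexes (as
families of faces) are `Δ ⊔ Γ` and `Δ ⊓ Γ`. -/
abbrev Complex (V : Type*) := LowerSet (Finset V)

section

variable {V : Type*}

/-- `F` is a facet of `Δ`: a face that is maximal with respect to inclusion. -/
def IsFacet (Δ : Complex V) (F : Finset V) : Prop :=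
  Maximal (fun G => G ∈ Δ) F

/-- The complex `Δ_F`: its faces are the subsets of the facets of `Δ` other than `F`. -/
def removeFacet (Δ : Complex V) (F : Finset V) : Complex V :=
  lowerClosure {G | IsFacet Δ G ∧ G ≠ F}

open Classical in
/-- The dimension of `Δ`, the maximum of `|F| - 1` over the faces `F`. It is `-1` for the complex
whose only face is the empty set, and `⊥` (that is, `-∞`) for the void complex. -/
noncomputable def dim [Fintype V] (Δ : Complex V) : WithBot ℤ :=
  (Finset.univ.filter (fun F : Finset V => F ∈ Δ)).sup
    (fun F => (((F.card : ℤ) - 1 : ℤ) : WithBot ℤ))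

variable (k : Type*) [Field k]

/-- The Stanley-Reisner ideal of `Δ` in `k[x_v : v ∈ V]`, generated by the squarefree monomials
`∏_{v ∈ F} x_v` of the non-faces `F` of `Δ`. -/
noncomputable def stanleyReisnerIdeal (Δ : Complex V) : Ideal (MvPolynomial V k) :=
  Ideal.span {p | ∃ F : Finset V, F ∉ Δ ∧ p = ∏ v ∈ F, MvPolynomial.X v}

/-- The Stanley-Reisner ring `k[Δ]`. -/
abbrev StanleyReisnerRing (Δ : Complex V) :=
  MvPolynomial V k ⧸ stanleyReisnerIdeal k Δ

/-- The depth of `Δ`: the depth of `k[Δ]`, i.e. the supremum of the lengths of the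
`k[Δ]`-regular sequences in the homogeneous maximal ideal `(x_v : v ∈ V)`.

For a nonzero `k[Δ]`, the requirement `k[Δ] ≠ (r₁, …, r_m) k[Δ]` in the definition of a regular
sequence holds automatically for `r_i ∈ (x_v : v ∈ V)`, so that "weakly regular" is the same as
"regular" here. For the void complex `k[Δ] = 0`, whose depth is `∞` by the usual convention. -/
noncomputable def depth (Δ : Complex V) : ℕ∞ :=
  sSup {n : ℕ∞ | ∃ rs : List (MvPolynomial V k),
    (∀ r ∈ rs, r ∈ Ideal.span (Set.range (MvPolynomial.X : V → MvPolynomial V k))) ∧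
    RingTheory.Sequence.IsWeaklyRegular (StanleyReisnerRing k Δ) rs ∧
    (rs.length : ℕ∞) = n}

/-- `Δ` is Cohen-Macaulay over `k`: if `Δ` has dimension `d - 1`, then its depth is `d`. The void
complex, which has `k[Δ] = 0`, counts as Cohen-Macaulay, as the zero module does. -/
def IsCM [Fintype V] (Δ : Complex V) : Prop :=
  Δ = ⊥ ∨ ∃ d : ℕ, dim Δ = (((d : ℤ) - 1 : ℤ) : WithBot ℤ) ∧ depth k Δ = (d : ℕ∞)

/-- `Δ` is minimal Cohen-Macaulay: it is Cohen-Macaulay, and no `Δ_F`, for `F` a facet of `Δ`, is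
Cohen-Macaulay. -/
def IsMinimalCM [Fintype V] (Δ : Complex V) : Prop :=
  IsCM k Δ ∧ ∀ F : Finset V, IsFacet Δ F → ¬ IsCM k (removeFacet Δ F)

/-- `Δ` is strongly Cohen-Macaulay: it is Cohen-Macaulay, and so is `Δ_F` for every facet `F`
of `Δ`. -/
def IsStronglyCM [Fintype V] (Δ : Complex V) : Prop :=
  IsCM k Δ ∧ ∀ F : Finset V, IsFacet Δ F → IsCM k (removeFacet Δ F)

end

end MinimalCM

/-! By Hochster, k[Δ] has depth at least n exactly when every restriction Δ|_W has no reduced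
cohomology on faces with j elements for j + |V∖W| < n
(`exists_isWeaklyRegular_iff_restrictionsExact`). The proposition thereby becomes a statement about
simplicial cochains, and Mayer–Vietoris on each W shows that U = Δ ∪ Γ is CM.

Suppose that U_F is CM for a facet F of U. Let H ⊆ F be minimal among the sets outside U_F, and let
W = V∖(F∖H). On W the complexes U and U_F differ only in H, so the indicator cochain of H is not a
coboundary on U|_W (`not_isCoboundary_single`). Since Δ ∩ Γ has no cohomology one degree lower,
Mayer–Vietoris (`IsCoboundary.sup`) shows that it is not a coboundary on one of Δ|_W and Γ|_W, say
on Δ|_W. Then F is a facet of Δ. Passing to the link of F∖H (`IsCoboundary.of_star`) shows that each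
F∖{v} with v ∈ H lies in another facet of Δ, so removing F deletes exactly the interval [H, F].
Because the class of H is nonzero, this deletion preserves the vanishing of cohomology
(`RestrictionsExact.of_not_isCoboundary_single`). Hence Δ_F is CM, against the minimality of Δ. -/

namespace MinimalCM

/-! ### The Koszul cochain complex and its contracting homotopies. -/

section Koszul

variable {V : Type*} [LinearOrder V]

/-- The sign of inserting `v` into `T`. -/
def sgn (v : V) (T : Finset V) : ℤ := (-1) ^ (T.filter (· < v)).card

lemma sgn_mul_self (v : V) (T : Finset V) : sgn v T * sgn v T = 1 := by
  unfold sgn; rw [← pow_add, ← two_mul, pow_mul]; simp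

lemma sgn_union (v : V) {S T : Finset V} (h : Disjoint S T) :
    sgn v (S ∪ T) = sgn v S * sgn v T := by
  unfold sgn
  rw [Finset.filter_union, Finset.card_union_of_disjoint
    (Finset.disjoint_filter_filter h), pow_add]

lemma sgn_insert (u v : V) {T : Finset V} (hu : u ∉ T) :
    sgn v (insert u T) = sgn v {u} * sgn v T := by
  rw [Finset.insert_eq, sgn_union]; simpa using hu

lemma sgn_singleton_mul {u v : V} (h : u ≠ v) : sgn v {u} * sgn u {v} = -1 := by
  unfold sgn
  rcases lt_or_gt_of_ne h with h | h
  · simp [Finset.filter_singleton, h, h.not_gt]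
  · simp [Finset.filter_singleton, h, h.not_gt]

lemma sgn_swap {u v : V} {T : Finset V} (h : u ≠ v) (hu : u ∉ T) (hv : v ∉ T) :
    sgn v (insert u T) * sgn u T = -(sgn u (insert v T) * sgn v T) := by
  rw [sgn_insert u v hu, sgn_insert v u hv]
  have h1 := sgn_singleton_mul h
  have h2 := sgn_mul_self u {v}
  have : sgn v {u} = - sgn u {v} := by
    linear_combination sgn u {v} * h1 - sgn v {u} * h2
  rw [this]; ring

lemma sgn_cancel {u v : V} {T : Finset V} (h : u ≠ v) (hu : u ∉ T) (hv : v ∉ T) :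
    sgn u T * sgn v T + sgn v (insert u T) * sgn u (insert v T) = 0 := by
  rw [sgn_insert u v hu, sgn_insert v u hv]
  linear_combination sgn v T * sgn u T * sgn_singleton_mul h

variable {R M N : Type*} [CommRing R] [AddCommGroup M] [Module R M] [AddCommGroup N] [Module R N]

/-- The differential of the Koszul cochain complex of `M` with respect to the family `x`; its
cochains of degree `i` are the functions on the `i`-element sets. -/
def koszulD (x : V → R) : (Finset V → M) →ₗ[R] (Finset V → M) where
  toFun f T := ∑ v ∈ T, sgn v (T.erase v) • x v • f (T.erase v)
  map_add' f g := by ext T; simp [Finset.sum_add_distrib]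
  map_smul' r f := by
    ext T
    simp only [Pi.smul_apply, RingHom.id_apply, Finset.smul_sum]
    refine Finset.sum_congr rfl fun v _ => ?_
    rw [smul_comm (x v) r, smul_comm _ r]

lemma koszulD_apply (x : V → R) (f : Finset V → M) (T : Finset V) :
    koszulD x f T = ∑ v ∈ T, sgn v (T.erase v) • x v • f (T.erase v) := rfl

lemma koszulD_empty (x : V → R) (f : Finset V → M) : koszulD x f ∅ = 0 := by
  simp [koszulD_apply]

lemma koszulD_congr {x : V → R} {f g : Finset V → M} {T : Finset V}
    (h : ∀ v ∈ T, f (T.erase v) = g (T.erase v)) : koszulD x f T = koszulD x g T := by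
  simp only [koszulD_apply]
  exact Finset.sum_congr rfl fun v hv => by rw [h v hv]

lemma koszulD_eq_zero {x : V → R} {f : Finset V → M} {T : Finset V}
    (h : ∀ v ∈ T, f (T.erase v) = 0) : koszulD x f T = 0 := by
  rw [koszulD_apply]
  exact Finset.sum_eq_zero fun v hv => by rw [h v hv]; simp

lemma koszulD_map (φ : M →ₗ[R] N) (x : V → R) (f : Finset V → M) (T : Finset V) :
    koszulD x (fun T => φ (f T)) T = φ (koszulD x f T) := by
  simp [koszulD_apply]

lemma koszulD_koszulD (x : V → R) (f : Finset V → M) : koszulD x (koszulD x f) = 0 := by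
  ext T
  simp only [koszulD_apply, Finset.smul_sum, Pi.zero_apply]
  rw [Finset.sum_sigma']
  -- The terms that remove v and u in the two possible orders cancel.
  refine Finset.sum_involution (fun p _ => ⟨p.2, p.1⟩) ?_ ?_ ?_ ?_
  · rintro ⟨v, u⟩ h
    simp only [Finset.mem_sigma, Finset.mem_erase] at h
    obtain ⟨hv, huv, hu⟩ := h
    dsimp only
    have e1 : T.erase v = insert u ((T.erase v).erase u) := by
      rw [Finset.insert_erase]; simp [hu, huv]
    have e2 : T.erase u = insert v ((T.erase v).erase u) := by
      rw [Finset.erase_right_comm, Finset.insert_erase]; simp [hv, huv.symm]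
    have e3 : (T.erase u).erase v = (T.erase v).erase u := Finset.erase_right_comm
    rw [e3]
    have key := sgn_swap (T := (T.erase v).erase u) huv (by simp) (by simp)
    rw [← e1, ← e2] at key
    rw [smul_comm (x v) (sgn u _), smul_comm (x u) (sgn v _), smul_smul,
      smul_smul (sgn u _) (sgn v _), key, smul_comm (x u) (x v), neg_smul, neg_add_cancel]
  · rintro ⟨v, u⟩ h _ he
    simp only [Finset.mem_sigma, Finset.mem_erase] at h
    simp only [Sigma.mk.injEq] at he
    exact h.2.1 he.1
  · rintro ⟨v, u⟩ h
    simp only [Finset.mem_sigma, Finset.mem_erase] at h ⊢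
    exact ⟨h.2.2, h.2.1.symm, h.1⟩
  · rintro ⟨v, u⟩ _; rfl

lemma koszulD_koszulD_apply (x : V → R) (f : Finset V → M) (T : Finset V) :
    koszulD x (koszulD x f) T = 0 := congrFun (koszulD_koszulD x f) T

/-- Contraction with `v`, a homotopy between multiplication by `x v` and zero. -/
def contraction (v : V) (f : Finset V → M) (T : Finset V) : M :=
  if v ∈ T then 0 else sgn v T • f (insert v T)

lemma koszulD_contraction (x : V → R) (v : V) (f : Finset V → M) (T : Finset V) :
    koszulD x (contraction v f) T + contraction v (koszulD x f) T = x v • f T := by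
  by_cases hv : v ∈ T
  · rw [contraction, if_pos hv, add_zero, koszulD_apply, Finset.sum_eq_single v]
    · simp only [contraction, Finset.notMem_erase, if_false, Finset.insert_erase hv]
      rw [smul_comm (x v), smul_smul, sgn_mul_self, one_smul]
    · intro u hu huv
      simp [contraction, hv, huv.symm]
    · exact fun h => absurd hv h
  · rw [contraction, if_neg hv, koszulD_apply x f, Finset.sum_insert hv,
      Finset.erase_insert hv, smul_add, smul_smul, sgn_mul_self, one_smul, koszulD_apply,
      Finset.smul_sum, add_left_comm, ← Finset.sum_add_distrib, Finset.sum_eq_zero, add_zero]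
    intro u hu
    have huv : u ≠ v := fun h => hv (h ▸ hu)
    have e1 : (insert v T).erase u = insert v (T.erase u) := by
      rw [Finset.erase_insert_of_ne huv.symm]
    have e2 : T = insert u (T.erase u) := (Finset.insert_erase hu).symm
    have h1 : v ∉ T.erase u := fun h => hv (Finset.mem_of_mem_erase h)
    rw [contraction, if_neg h1, e1, smul_comm (x u), smul_smul, smul_smul, ← add_smul]
    have key := sgn_cancel (T := T.erase u) huv (by simp) h1
    rw [← e2] at key
    rw [key, zero_smul]

/-- Exactness in degree `j` of the Koszul cochain complex of `M` with respect to `x`. -/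
def KoszulExactAt (x : V → R) (M : Type*) [AddCommGroup M] [Module R M] (j : ℕ) : Prop :=
  ∀ f : Finset V → M, (∀ T, T.card = j + 1 → koszulD x f T = 0) →
    ∃ g : Finset V → M, ∀ T, T.card = j → koszulD x g T = f T

end Koszul

/-! ### Depth and Koszul cohomology. -/

section Rees

open RingTheory.Sequence

variable {V : Type*} [LinearOrder V]
variable {R M : Type*} [CommRing R] [AddCommGroup M] [Module R M]

/-- The ideal generated by the family annihilates Koszul cohomology: contraction is the homotopy for
each generator. -/
lemma exists_koszulD_eq_smul {x : V → R} {r : R} (hr : r ∈ Ideal.span (Set.range x)) {i : ℕ}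
    {f : Finset V → M} (hf : ∀ T, T.card = i + 1 → koszulD x f T = 0) :
    ∃ g : Finset V → M, ∀ T, T.card = i → koszulD x g T = r • f T := by
  induction hr using Submodule.span_induction with
  | mem r h =>
    obtain ⟨v, rfl⟩ := h
    refine ⟨contraction v f, fun T hT => ?_⟩
    rw [← koszulD_contraction x v f T, left_eq_add, contraction]
    split_ifs with hv
    · rfl
    · rw [hf _ (by rw [Finset.card_insert_of_notMem hv, hT]), smul_zero]
  | zero => exact ⟨0, fun T _ => by simp⟩
  | add a b _ _ ha hb =>
    obtain ⟨g, hg⟩ := ha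
    obtain ⟨g', hg'⟩ := hb
    exact ⟨g + g', fun T hT => by rw [map_add, Pi.add_apply, hg T hT, hg' T hT, add_smul]⟩
  | smul a b _ hb =>
    obtain ⟨g, hg⟩ := hb
    exact ⟨a • g, fun T hT => by rw [map_smul, Pi.smul_apply, hg T hT, smul_eq_mul, mul_smul]⟩

lemma mk_quotSMulTop_eq_zero {r : R} {m : M} :
    (Submodule.Quotient.mk m : QuotSMulTop r M) = 0 ↔ ∃ m', r • m' = m := by
  rw [Submodule.Quotient.mk_eq_zero, Submodule.mem_smul_pointwise_iff_exists]
  simp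

lemma koszulD_mk (r : R) (x : V → R) (f : Finset V → M) (T : Finset V) :
    koszulD x (fun T => (Submodule.Quotient.mk (f T) : QuotSMulTop r M)) T =
      Submodule.Quotient.mk (koszulD x f T) :=
  koszulD_map (Submodule.mkQ _) x f T

/-- The long exact sequence of multiplication by `r` places the cohomology of M/rM between H^i(M)
and H^(i+1)(M). Concretely, if df = r h for a lift f, then h is a cocycle by regularity, h = dg, and
f - r g is a cocycle. -/
lemma KoszulExactAt.quotSMulTop {x : V → R} {r : R} (hr : IsSMulRegular M r) {i : ℕ}
    (h0 : KoszulExactAt x M i) (h1 : KoszulExactAt x M (i + 1)) :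
    KoszulExactAt x (QuotSMulTop r M) i := by
  intro f' hf'
  obtain ⟨f, rfl⟩ : ∃ f : Finset V → M, f' = fun T => Submodule.Quotient.mk (f T) := by
    choose f hf using fun T => Submodule.Quotient.mk_surjective _ (f' T)
    exact ⟨f, funext fun T => (hf T).symm⟩
  have hdiv : ∀ T : Finset V, ∃ m, T.card = i + 1 → r • m = koszulD x f T := by
    intro T
    by_cases hT : T.card = i + 1
    · have := hf' T hT
      rw [koszulD_mk, mk_quotSMulTop_eq_zero] at this
      obtain ⟨m, hm⟩ := this
      exact ⟨m, fun _ => hm⟩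
    · exact ⟨0, fun h => absurd h hT⟩
  choose h hh using hdiv
  obtain ⟨g, hg⟩ := h1 h fun T hT => hr <| by
    change r • koszulD x h T = r • 0
    rw [smul_zero, ← Pi.smul_apply, ← map_smul, ← koszulD_koszulD_apply x f T]
    refine koszulD_congr fun v hv => ?_
    rw [Pi.smul_apply, hh]
    rw [Finset.card_erase_of_mem hv, hT]; rfl
  obtain ⟨e, he⟩ := h0 (f - r • g) fun T hT => by
    rw [map_sub, map_smul, Pi.sub_apply, Pi.smul_apply, hg T hT, hh T hT, sub_self]
  refine ⟨fun T => Submodule.Quotient.mk (e T), fun T hT => ?_⟩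
  rw [koszulD_mk, he T hT, Submodule.Quotient.eq, ← Submodule.Quotient.mk_eq_zero,
    mk_quotSMulTop_eq_zero]
  exact ⟨-g T, by simp⟩

lemma koszulExactAt_zero_of_regular {x : V → R} {r : R} (hm : r ∈ Ideal.span (Set.range x))
    (hr : IsSMulRegular M r) : KoszulExactAt x M 0 := by
  intro f hf
  obtain ⟨g, hg⟩ := exists_koszulD_eq_smul hm hf
  refine ⟨g, fun T hT => ?_⟩
  rw [Finset.card_eq_zero] at hT
  subst hT
  apply hr
  change r • _ = r • _
  rw [← hg ∅ rfl, koszulD_empty, smul_zero]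

/-- Multiplication by `r` is zero on cohomology, so the connecting map from H^i(M/rM) to H^(i+1)(M)
is onto. Concretely, r f = dg with g = de + r p, so r f = r dp. -/
lemma KoszulExactAt.of_quotSMulTop {x : V → R} {r : R} (hm : r ∈ Ideal.span (Set.range x))
    (hr : IsSMulRegular M r) {i : ℕ} (h : KoszulExactAt x (QuotSMulTop r M) i) :
    KoszulExactAt x M (i + 1) := by
  intro f hf
  obtain ⟨g, hg⟩ := exists_koszulD_eq_smul hm hf
  obtain ⟨e', he'⟩ := h (fun T => Submodule.Quotient.mk (g T)) fun T hT => by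
    rw [koszulD_mk, hg T hT, mk_quotSMulTop_eq_zero]
    exact ⟨_, rfl⟩
  choose e he using fun T => Submodule.Quotient.mk_surjective _ (e' T)
  obtain rfl : (fun T => Submodule.Quotient.mk (e T)) = e' := funext he
  have hdiv : ∀ T : Finset V, ∃ m, T.card = i → r • m = g T - koszulD x e T := by
    intro T
    by_cases hT : T.card = i
    · have := he' T hT
      rw [koszulD_mk, eq_comm, Submodule.Quotient.eq, ← Submodule.Quotient.mk_eq_zero,
        mk_quotSMulTop_eq_zero] at this
      obtain ⟨m, hm⟩ := this
      exact ⟨m, fun _ => hm⟩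
    · exact ⟨0, fun h => absurd h hT⟩
  choose p hp using hdiv
  refine ⟨p, fun T hT => hr ?_⟩
  change r • koszulD x p T = r • f T
  rw [← hg T hT, ← Pi.smul_apply, ← map_smul]
  have : koszulD x (r • p) T = koszulD x (g - koszulD x e) T := by
    refine koszulD_congr fun v hv => ?_
    rw [Pi.smul_apply, hp, Pi.sub_apply]
    rw [Finset.card_erase_of_mem hv, hT]; rfl
  rw [this, map_sub, Pi.sub_apply, koszulD_koszulD_apply, sub_zero]

/-- By prime avoidance, an ideal of zero divisors lies in an associated prime, the annihilator of
some z. Such a z is a cocycle in degree 0, where the only coboundary is 0. -/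
lemma exists_isSMulRegular_of_koszulExactAt_zero [IsNoetherianRing R] [Module.Finite R M]
    {x : V → R} (h : KoszulExactAt x M 0) :
    ∃ r ∈ Ideal.span (Set.range x), IsSMulRegular M r := by
  by_contra! hc
  have hsub : ((Ideal.span (Set.range x) : Ideal R) : Set R) ⊆
      ⋃ p ∈ ((associatedPrimes.finite R M).toFinset : Set (Ideal R)), (p : Set R) := by
    intro r hr
    rw [Set.Finite.coe_toFinset, biUnion_associatedPrimes_eq_compl_regular]
    exact hc r hr
  rw [Ideal.subset_union_prime ⊥ ⊥ (fun p hp _ _ => by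
    rw [Set.Finite.mem_toFinset] at hp
    exact IsAssociatedPrime.isPrime hp)] at hsub
  obtain ⟨p, hp, hle⟩ := hsub
  rw [Set.Finite.mem_toFinset, AssociatedPrimes.mem_iff, isAssociatedPrime_iff] at hp
  obtain ⟨hprime, z, rfl⟩ := hp
  have hz : ∀ r ∈ Ideal.span (Set.range x), r • z = 0 := fun r hr => by
    simpa [Submodule.mem_colon_singleton] using hle hr
  obtain ⟨g, hg⟩ := h (fun _ => z) fun T _ => by
    rw [koszulD_apply]
    exact Finset.sum_eq_zero fun v _ => by
      rw [hz _ (Ideal.subset_span ⟨v, rfl⟩), smul_zero]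
  have : z = 0 := by rw [← hg ∅ rfl, koszulD_empty]
  exact hprime.ne_top ((Ideal.eq_top_iff_one _).2 (by simp [this, Submodule.mem_colon_singleton]))

/-- Depth is detected by the vanishing of Koszul cohomology. -/
theorem exists_isWeaklyRegular_iff {R : Type*} [CommRing R] [IsNoetherianRing R] (x : V → R)
    (n : ℕ) : ∀ (M : Type*) [AddCommGroup M] [Module R M] [Module.Finite R M],
    (∃ rs : List R, (∀ r ∈ rs, r ∈ Ideal.span (Set.range x)) ∧ IsWeaklyRegular M rs ∧
      rs.length = n) ↔ ∀ i < n, KoszulExactAt x M i := by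
  induction n with
  | zero =>
    intro M _ _ _
    simp only [not_lt_zero, IsEmpty.forall_iff, implies_true, iff_true]
    exact ⟨[], by simp⟩
  | succ n ih =>
    intro M _ _ _
    constructor
    · rintro ⟨rs, hm, hreg, hlen⟩
      obtain _ | ⟨r, rs⟩ := rs
      · simp at hlen
      rw [isWeaklyRegular_cons_iff] at hreg
      have hr := hm r (by simp)
      have h := (ih (QuotSMulTop r M)).1 ⟨rs, fun s hs => hm s (by simp [hs]), hreg.2,
        by simpa using hlen⟩
      intro i hi
      obtain _ | i := i
      · exact koszulExactAt_zero_of_regular hr hreg.1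
      · exact (h i (by lia)).of_quotSMulTop hr hreg.1
    · intro h
      obtain ⟨r, hr, hreg⟩ := exists_isSMulRegular_of_koszulExactAt_zero (h 0 (by lia))
      obtain ⟨rs, h1, h2, h3⟩ := (ih (QuotSMulTop r M)).2 fun i hi =>
        (h i (by lia)).quotSMulTop hreg (h (i + 1) (by lia))
      refine ⟨r :: rs, ?_, (isWeaklyRegular_cons_iff M r rs).2 ⟨hreg, h2⟩, by simp [h3]⟩
      simpa using ⟨hr, h1⟩

end Rees

/-! ### Multigraded pieces of the Koszul complex of k[Δ], and Hochster's criterion. -/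

section Hochster

lemma exists_lift {k V : Type*} [Field k] {Δ : Complex V} (f : Finset V → StanleyReisnerRing k Δ) :
    ∃ p : Finset V → MvPolynomial V k, f = fun T => Ideal.Quotient.mk _ (p T) := by
  choose p hp using fun T => Ideal.Quotient.mk_surjective (f T)
  exact ⟨p, funext fun T => (hp T).symm⟩

variable (k : Type*) [Field k] {V : Type*} [LinearOrder V]

/-- `φ` is a cocycle on the faces with `j` elements of the restriction of `Δ` to `W`. -/
def IsCocycle {k : Type*} [Field k] (Δ : Complex V) (W : Finset V) (j : ℕ) (φ : Finset V → k) :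
    Prop :=
  ∀ T ∈ Δ, T ⊆ W → T.card = j + 1 → koszulD (1 : V → k) φ T = 0

/-- `φ` is a coboundary on the faces with `j` elements of the restriction of `Δ` to `W`. -/
def IsCoboundary {k : Type*} [Field k] (Δ : Complex V) (W : Finset V) (j : ℕ) (φ : Finset V → k) :
    Prop :=
  ∃ ψ : Finset V → k, ∀ T ∈ Δ, T ⊆ W → T.card = j → koszulD (1 : V → k) ψ T = φ T

/-- Exactness, at the faces with `j` elements, of the augmented simplicial cochain complex of the
restriction of `Δ` to `W`. -/
def ExactAt (Δ : Complex V) (W : Finset V) (j : ℕ) : Prop :=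
  ∀ φ : Finset V → k, IsCocycle Δ W j φ → IsCoboundary Δ W j φ

/-- The vanishing of the low-degree cohomology of all restrictions of `Δ`, a complex on the vertex
set `P`, that characterizes depth at least `n`. -/
def RestrictionsExact (n : ℕ) (Δ : Complex V) (P : Finset V) : Prop :=
  ∀ W ⊆ P, ∀ j, j + (P \ W).card < n → ExactAt k Δ W j

variable {k}

/-- The sign that compares the differentials at `T ∪ N` and at `T`. -/
def twist (N T : Finset V) : ℤ := ∏ v ∈ T, sgn v N

lemma twist_mul_self (N T : Finset V) : twist N T * twist N T = 1 := by
  rw [twist, ← Finset.prod_mul_distrib]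
  exact Finset.prod_eq_one fun v _ => sgn_mul_self v N

lemma twist_smul_twist_smul (N T : Finset V) (c : k) : twist N T • twist N T • c = c := by
  rw [smul_smul, twist_mul_self, one_smul]

lemma twist_mul_erase {N T : Finset V} {v : V} (hv : v ∈ T) :
    twist N T * twist N (T.erase v) = sgn v N := by
  have : twist N T = sgn v N * twist N (T.erase v) := (Finset.mul_prod_erase T _ hv).symm
  rw [this, mul_assoc, twist_mul_self, mul_one]

/-- Where the weights vanish on `N` and equal 1 on `T`, the Koszul differential is the simplicial
one on the sets containing `N`, up to signs that conjugation by `twist` absorbs. -/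
lemma koszulD_union {N T : Finset V} (hd : Disjoint T N) {y : V → k}
    (h0 : ∀ v ∈ N, y v = 0) (h1 : ∀ v ∈ T, y v = 1) (f : Finset V → k) :
    koszulD y f (T ∪ N) =
      twist N T • koszulD (1 : V → k) (fun S => twist N S • f (S ∪ N)) T := by
  simp only [koszulD_apply]
  rw [Finset.sum_union hd, Finset.sum_eq_zero (s := N), add_zero, Finset.smul_sum]
  · refine Finset.sum_congr rfl fun v hv => ?_
    have hvN : v ∉ N := Finset.disjoint_left.1 hd hv
    have e : (T ∪ N).erase v = T.erase v ∪ N := by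
      rw [Finset.erase_union_distrib, Finset.erase_eq_of_notMem hvN]
    rw [e, h1 v hv, sgn_union v (hd.mono_left (Finset.erase_subset _ _)), ← twist_mul_erase (N := N) hv,
      Pi.one_apply, one_smul, one_smul, smul_smul, smul_smul]
    congr 1
    ring
  · intro v hv
    rw [h0 v hv, zero_smul, smul_zero]

/-- The exponent of the squarefree monomial with support `T`. -/
noncomputable def expo (T : Finset V) : V →₀ ℕ := ∑ v ∈ T, Finsupp.single v 1

lemma expo_apply (T : Finset V) (v : V) : expo T v = if v ∈ T then 1 else 0 := by
  simp [expo, Finsupp.finsetSum_apply, Finsupp.single_apply]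

lemma support_expo (T : Finset V) : (expo T).support = T := by
  ext v; simp [expo_apply]

lemma expo_le_iff {T : Finset V} {a : V →₀ ℕ} : expo T ≤ a ↔ T ⊆ a.support := by
  constructor
  · intro h v hv
    have := h v
    rw [expo_apply, if_pos hv] at this
    rw [Finsupp.mem_support_iff]; lia
  · intro h v
    rw [expo_apply]
    split_ifs with hv
    · have := Finsupp.mem_support_iff.1 (h hv); lia
    · exact Nat.zero_le _

lemma expo_sub_single {T : Finset V} {v : V} :
    expo T - Finsupp.single v 1 = expo (T.erase v) := by
  ext u
  rw [Finsupp.tsub_apply, expo_apply, expo_apply, Finsupp.single_apply]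
  by_cases h : v = u
  · subst h; simp; split_ifs <;> rfl
  · simp [h, Ne.symm h]

lemma mem_stanleyReisnerIdeal_iff {Δ : Complex V} {p : MvPolynomial V k} :
    p ∈ stanleyReisnerIdeal k Δ ↔ ∀ a : V →₀ ℕ, a.support ∈ Δ → p.coeff a = 0 := by
  have hset : {p : MvPolynomial V k | ∃ F : Finset V, F ∉ Δ ∧ p = ∏ v ∈ F, MvPolynomial.X v} =
      (fun a => MvPolynomial.monomial a (1 : k)) '' {a | ∃ F : Finset V, F ∉ Δ ∧ a = expo F} := by
    have hprod : ∀ F : Finset V, (∏ v ∈ F, MvPolynomial.X v : MvPolynomial V k) =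
        MvPolynomial.monomial (expo F) 1 := fun F => by
      rw [expo, MvPolynomial.monomial_sum_one]; rfl
    ext p
    constructor
    · rintro ⟨F, hF, rfl⟩
      exact ⟨expo F, ⟨F, hF, rfl⟩, (hprod F).symm⟩
    · rintro ⟨_, ⟨F, hF, rfl⟩, rfl⟩
      exact ⟨F, hF, (hprod F).symm⟩
  rw [stanleyReisnerIdeal, hset, MvPolynomial.mem_ideal_span_monomial_image]
  constructor
  · intro h a ha
    by_contra hc
    obtain ⟨_, ⟨F, hF, rfl⟩, hle⟩ := h a (MvPolynomial.mem_support_iff.2 hc)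
    exact hF (Δ.lower (expo_le_iff.1 hle) ha)
  · intro h a ha
    exact ⟨expo a.support, ⟨_, fun hc => MvPolynomial.mem_support_iff.1 ha (h a hc), rfl⟩,
      expo_le_iff.2 subset_rfl⟩

lemma coeff_koszulD (p : Finset V → MvPolynomial V k) (T : Finset V) (a : V →₀ ℕ) :
    (koszulD (MvPolynomial.X (R := k)) p T).coeff a = ∑ v ∈ T, sgn v (T.erase v) •
      (if v ∈ a.support then (p (T.erase v)).coeff (a - Finsupp.single v 1) else 0) := by
  rw [koszulD_apply, MvPolynomial.coeff_sum]
  refine Finset.sum_congr rfl fun v _ => ?_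
  rw [MvPolynomial.coeff_smul, smul_eq_mul, MvPolynomial.coeff_X_mul']

lemma koszulD_mk_eq_mk_iff {Δ : Complex V} {p q : Finset V → MvPolynomial V k} {T : Finset V} :
    koszulD (MvPolynomial.X (R := k)) (fun T => (Ideal.Quotient.mk _ (q T) : StanleyReisnerRing k Δ)) T =
      Ideal.Quotient.mk _ (p T) ↔
    ∀ a : V →₀ ℕ, a.support ∈ Δ → (koszulD (MvPolynomial.X (R := k)) q T).coeff a = (p T).coeff a := by
  have := koszulD_map (Submodule.mkQ (stanleyReisnerIdeal k Δ)) MvPolynomial.X q T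
  change koszulD (MvPolynomial.X (R := k)) (fun T => Ideal.Quotient.mk _ (q T)) T =
    Ideal.Quotient.mk _ (koszulD (MvPolynomial.X (R := k)) q T) at this
  rw [this, Ideal.Quotient.eq, mem_stanleyReisnerIdeal_iff]
  simp only [MvPolynomial.coeff_sub, sub_eq_zero]

lemma koszulD_mk_eq_zero_iff {Δ : Complex V} {q : Finset V → MvPolynomial V k} {T : Finset V} :
    koszulD (MvPolynomial.X (R := k)) (fun T => (Ideal.Quotient.mk _ (q T) : StanleyReisnerRing k Δ)) T = 0 ↔
    ∀ a : V →₀ ℕ, a.support ∈ Δ → (koszulD (MvPolynomial.X (R := k)) q T).coeff a = 0 := by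
  have := koszulD_mk_eq_mk_iff (Δ := Δ) (p := 0) (q := q) (T := T)
  simpa using this

/-- The strand of multidegree -1 on the complement N of `W` and 0 on `W` is, up to sign, the cochain
complex of Δ restricted to `W`, shifted by |N|: a face T corresponds to the monomial x^T in the
component T ∪ N. -/
lemma exactAt_of_koszulExactAt [Fintype V] {Δ : Complex V} {W : Finset V} {j : ℕ}
    (h : KoszulExactAt (MvPolynomial.X : V → MvPolynomial V k) (StanleyReisnerRing k Δ)
      (j + (Finset.univ \ W).card)) : ExactAt k Δ W j := by
  intro φ hφ
  set N := Finset.univ \ W with hN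
  have hdisj : ∀ {T}, T ⊆ W → Disjoint T N := fun hT =>
    Finset.disjoint_of_subset_left hT Finset.disjoint_sdiff
  let y : V → k := fun v => if v ∈ N then 0 else 1
  have hy0 : ∀ v ∈ N, y v = 0 := fun v hv => if_pos hv
  have hy1 : ∀ {T}, T ⊆ W → ∀ v ∈ T, y v = 1 := fun hT v hv =>
    if_neg (Finset.disjoint_left.1 (hdisj hT) hv)
  let Φ : Finset V → k := fun T => twist N (T \ N) • φ (T \ N)
  let p : Finset V → MvPolynomial V k := fun T =>
    if N ⊆ T then MvPolynomial.monomial (expo (T \ N)) (Φ T) else 0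
  obtain ⟨g, hg⟩ := h (fun T => Ideal.Quotient.mk _ (p T)) fun T hT => by
    rw [koszulD_mk_eq_zero_iff]
    intro a ha
    rw [coeff_koszulD]
    by_cases hc : N ⊆ T ∧ a = expo (T \ N)
    · obtain ⟨hNT, rfl⟩ := hc
      rw [support_expo] at ha
      have hW : T \ N ⊆ W := fun v hv => by
        simp only [hN, Finset.mem_sdiff, Finset.mem_univ, true_and, not_not] at hv
        exact hv.2
      trans koszulD y Φ T
      · rw [koszulD_apply]
        refine Finset.sum_congr rfl fun v hv => ?_
        rw [support_expo, expo_sub_single]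
        by_cases hvN : v ∈ N
        · rw [if_neg (by simp [hvN]), hy0 v hvN, zero_smul]
        · have hs : N ⊆ T.erase v := fun u hu =>
            Finset.mem_erase.2 ⟨fun h => hvN (h ▸ hu), hNT hu⟩
          rw [if_pos (by simp [hv, hvN]), show y v = 1 from if_neg hvN, one_smul]
          simp only [p, if_pos hs]
          rw [Finset.erase_sdiff_comm, MvPolynomial.coeff_monomial, if_pos rfl]
      · rw [← Finset.sdiff_union_of_subset hNT, koszulD_union (hdisj hW) hy0 (hy1 hW)]
        rw [koszulD_congr (g := φ), hφ _ ha hW, smul_zero]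
        · rw [Finset.card_sdiff_of_subset hNT, hT]; lia
        · intro v hv
          have e : ((T \ N).erase v ∪ N) \ N = (T \ N).erase v := by
            rw [Finset.union_sdiff_right, Finset.sdiff_eq_self_of_disjoint]
            exact (hdisj hW).mono_left (Finset.erase_subset _ _)
          simp only [Φ]
          rw [e, twist_smul_twist_smul]
    · refine Finset.sum_eq_zero fun v hv => ?_
      split_ifs with hav
      · simp only [p]
        split_ifs with hs
        · rw [MvPolynomial.coeff_monomial, if_neg, smul_zero]
          intro he
          refine hc ⟨hs.trans (Finset.erase_subset _ _), ?_⟩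
          have hvN : v ∉ N := fun h => by simpa using hs h
          rw [Finset.erase_sdiff_comm, ← expo_sub_single] at he
          have h1 : Finsupp.single v 1 ≤ a := by
            rw [Finsupp.single_le_iff]
            have := Finsupp.mem_support_iff.1 hav; lia
          have h2 : Finsupp.single v 1 ≤ expo (T \ N) := by
            rw [Finsupp.single_le_iff, expo_apply, if_pos (by simp [hv, hvN])]
          rw [← tsub_add_cancel_of_le h1, ← he, tsub_add_cancel_of_le h2]
        · simp
      · simp
  obtain ⟨q, rfl⟩ := exists_lift g
  -- The simplicial primitive is read off from the coefficients of the Koszul primitive in the same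
  -- multidegree.
  let Ψ : Finset V → k := fun T => (q T).coeff (expo (T \ N))
  refine ⟨fun T => twist N T • Ψ (T ∪ N), fun T hT hTW hTj => ?_⟩
  have hd := hdisj hTW
  have hTN : (T ∪ N) \ N = T := by
    rw [Finset.union_sdiff_right, Finset.sdiff_eq_self_of_disjoint hd]
  have h1 := koszulD_mk_eq_mk_iff.1 (hg (T ∪ N) (by
    rw [Finset.card_union_of_disjoint hd, hTj])) (expo T) (by rwa [support_expo])
  have h2 : (koszulD (MvPolynomial.X (R := k)) q (T ∪ N)).coeff (expo T) = koszulD y Ψ (T ∪ N) := by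
    rw [coeff_koszulD, koszulD_apply]
    refine Finset.sum_congr rfl fun v hv => ?_
    rw [support_expo, expo_sub_single]
    by_cases hvT : v ∈ T
    · have hvN : v ∉ N := Finset.disjoint_left.1 hd hvT
      rw [if_pos hvT, show y v = 1 from if_neg hvN, one_smul]
      simp only [Ψ]
      rw [Finset.erase_sdiff_comm, hTN]
    · have hvN : v ∈ N := (Finset.mem_union.1 hv).resolve_left hvT
      rw [if_neg hvT, hy0 v hvN, zero_smul]
  rw [h2, koszulD_union hd hy0 (hy1 hTW)] at h1
  simp only [p, Φ] at h1
  rw [if_pos Finset.subset_union_right, hTN, MvPolynomial.coeff_monomial, if_pos rfl] at h1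
  rw [← twist_smul_twist_smul N T (koszulD _ _ _), h1, twist_smul_twist_smul]

/-- The degree in `ℤ^V` of the monomial with exponent `a` in the component of the Koszul complex
indexed by `T`. -/
def multidegree (a : V →₀ ℕ) (T : Finset V) : V → ℤ :=
  fun v => a v - if v ∈ T then 1 else 0

/-- The exponent of the monomial of degree `b` in the component of the Koszul complex indexed by
`T`. -/
noncomputable def exponentAt [Fintype V] (b : V → ℤ) (T : Finset V) : V →₀ ℕ :=
  Finsupp.equivFunOnFinite.symm fun v => (b v + if v ∈ T then 1 else 0).toNat

/-- The component indexed by `T` of the Koszul complex has a monomial of degree `b`. -/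
def Admissible (b : V → ℤ) (T : Finset V) : Prop := ∀ v, 0 ≤ b v + if v ∈ T then 1 else 0

/-- The coefficients of the Koszul differential in degree `b`. -/
noncomputable def degreeWeight (k : Type*) [Field k] (b : V → ℤ) : V → k :=
  fun v => if 0 ≤ b v then 1 else 0

lemma exponentAt_apply [Fintype V] (b : V → ℤ) (T : Finset V) (v : V) :
    exponentAt b T v = (b v + if v ∈ T then 1 else 0).toNat := rfl

lemma exponentAt_multidegree [Fintype V] (a : V →₀ ℕ) (T : Finset V) :
    exponentAt (multidegree a T) T = a := by
  ext v; simp [exponentAt_apply, multidegree]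

lemma admissible_multidegree (a : V →₀ ℕ) (T : Finset V) : Admissible (multidegree a T) T := by
  intro v; simp [multidegree]

lemma multidegree_exponentAt [Fintype V] {b : V → ℤ} {T : Finset V} (h : Admissible b T) :
    multidegree (exponentAt b T) T = b := by
  ext v
  rw [multidegree, exponentAt_apply, Int.toNat_of_nonneg (h v)]; ring

lemma multidegree_sub_single {a : V →₀ ℕ} {T : Finset V} {v : V} (hv : v ∈ T)
    (ha : v ∈ a.support) : multidegree (a - Finsupp.single v 1) (T.erase v) = multidegree a T := by
  ext u
  have := Finsupp.mem_support_iff.1 ha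
  simp only [multidegree, Finsupp.tsub_apply, Finsupp.single_apply, Finset.mem_erase]
  by_cases h : v = u
  · subst h
    simp only [if_true, ne_eq, not_true_eq_false, false_and, if_false, if_pos hv]
    lia
  · simp [h, Ne.symm h]

/-- A multidegree with a positive entry at v is contractible, since v lies in the support of the
exponent whether or not v ∈ T. One with an entry below -1 is empty. The remaining multidegrees have
entries 0 and -1 and give the restrictions of Δ. -/
lemma koszulD_exact_of_degree [Fintype V] {n i : ℕ} (hi : i < n) {Δ : Complex V}
    (hΔ : RestrictionsExact k n Δ Finset.univ) (b : V → ℤ) (Φ : Finset V → k)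
    (hΦ : ∀ T, T.card = i + 1 → Admissible b T → (exponentAt b T).support ∈ Δ →
      koszulD (degreeWeight k b) Φ T = 0) :
    ∃ Ψ : Finset V → k, ∀ T, T.card = i → Admissible b T → (exponentAt b T).support ∈ Δ →
      koszulD (degreeWeight k b) Ψ T = Φ T := by
  by_cases h1 : ∃ v, 1 ≤ b v
  · obtain ⟨v, hv⟩ := h1
    refine ⟨contraction v Φ, fun T hT hadm hsupp => ?_⟩
    have hw : degreeWeight k b v = 1 := if_pos (by lia)
    rw [← one_smul k (Φ T), ← hw, ← koszulD_contraction (degreeWeight k b) v Φ T, left_eq_add,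
      contraction]
    split_ifs with hvT
    · rfl
    · have hle : ∀ u, b u + (if u ∈ T then 1 else 0) ≤ b u + (if u ∈ insert v T then 1 else 0) :=
        fun u => by
          simp only [Finset.mem_insert]
          split_ifs <;> simp_all
      rw [hΦ _ (by rw [Finset.card_insert_of_notMem hvT, hT]) (fun u => (hadm u).trans (hle u)),
        smul_zero]
      convert hsupp using 1
      ext u
      simp only [Finsupp.mem_support_iff, exponentAt_apply, Finset.mem_insert]
      by_cases huv : u = v
      · subst huv
        simp only [true_or, if_true, if_neg hvT]
        lia
      · simp [huv]
  push Not at h1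
  by_cases h2 : ∃ v, b v < -1
  · obtain ⟨v, hv⟩ := h2
    refine ⟨0, fun T _ hadm _ => ?_⟩
    have := hadm v
    split_ifs at this <;> lia
  push Not at h2
  set N : Finset V := Finset.univ.filter fun v => b v = -1 with hN
  have hbN : ∀ v ∈ N, b v = -1 := fun v hv => (Finset.mem_filter.1 hv).2
  have hb0 : ∀ v, v ∉ N → b v = 0 := fun v hv => by
    have : b v ≠ -1 := fun h => hv (by simp [hN, h])
    have := h1 v
    have := h2 v
    lia
  have hadm : ∀ T, Admissible b T ↔ N ⊆ T := by
    intro T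
    constructor
    · intro h v hv
      have := h v
      rw [hbN v hv] at this
      by_contra hvT
      rw [if_neg hvT] at this; lia
    · intro h v
      by_cases hv : v ∈ N
      · rw [hbN v hv, if_pos (h hv)]; lia
      · rw [hb0 v hv]; split_ifs <;> lia
  have hsupp : ∀ T, N ⊆ T → (exponentAt b T).support = T \ N := by
    intro T hT
    ext v
    simp only [Finsupp.mem_support_iff, exponentAt_apply, Finset.mem_sdiff]
    by_cases hv : v ∈ N
    · simp [hv, hbN v hv, hT hv]
    · by_cases hvT : v ∈ T <;> simp [hv, hb0 v hv, hvT]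
  have hy0 : ∀ v ∈ N, degreeWeight k b v = 0 := fun v hv =>
    if_neg (by rw [hbN v hv]; lia)
  have hy1 : ∀ v, v ∉ N → degreeWeight k b v = 1 := fun v hv =>
    if_pos (by rw [hb0 v hv])
  simp only [hadm]
  by_cases hcard : i < N.card
  · exact ⟨0, fun T hT hNT _ => by have := Finset.card_le_card hNT; lia⟩
  have hdisj : ∀ {T}, T ⊆ Finset.univ \ N → Disjoint T N := fun hT =>
    Finset.disjoint_of_subset_left hT Finset.sdiff_disjoint
  obtain ⟨ψ, hψ⟩ := hΔ (Finset.univ \ N) (Finset.subset_univ _) (i - N.card)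
    (by simp only [sdiff_sdiff_right_self, Finset.inf_eq_inter, Finset.univ_inter]; lia)
    (fun S => twist N S • Φ (S ∪ N)) fun T hT hTW hTc => by
      have hd := hdisj hTW
      have hs : N ⊆ T ∪ N := Finset.subset_union_right
      have := hΦ (T ∪ N) (by rw [Finset.card_union_of_disjoint hd]; lia) ((hadm _).2 hs)
        (by rwa [hsupp _ hs, Finset.union_sdiff_right, Finset.sdiff_eq_self_of_disjoint hd])
      rw [koszulD_union hd hy0 fun v hv => hy1 v (Finset.disjoint_left.1 hd hv)] at this
      rw [← twist_smul_twist_smul N T (koszulD _ _ _), this, smul_zero]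
  refine ⟨fun T => twist N (T \ N) • ψ (T \ N), fun T hT hNT hTΔ => ?_⟩
  rw [hsupp T hNT] at hTΔ
  have hTW : T \ N ⊆ Finset.univ \ N := Finset.sdiff_subset_sdiff (Finset.subset_univ _) subset_rfl
  have hd := hdisj hTW
  have key := hψ _ hTΔ hTW (by rw [Finset.card_sdiff_of_subset hNT, hT])
  simp only [Finset.sdiff_union_of_subset hNT] at key
  conv_lhs => rw [← Finset.sdiff_union_of_subset hNT]
  rw [koszulD_union hd hy0 fun v hv => hy1 v (Finset.disjoint_left.1 hd hv),
    koszulD_congr (g := ψ), key, twist_smul_twist_smul]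
  intro v hv
  have e : ((T \ N).erase v ∪ N) \ N = (T \ N).erase v := by
    rw [Finset.union_sdiff_right, Finset.sdiff_eq_self_of_disjoint]
    exact hd.mono_left (Finset.erase_subset _ _)
  rw [e, twist_smul_twist_smul]

lemma coeff_koszulD_eq (q : Finset V → MvPolynomial V k) (Ψ : Finset V → k) (a : V →₀ ℕ)
    (T : Finset V)
    (h : ∀ v ∈ T, v ∈ a.support →
      (q (T.erase v)).coeff (a - Finsupp.single v 1) = Ψ (T.erase v)) :
    (koszulD (MvPolynomial.X (R := k)) q T).coeff a =
      koszulD (degreeWeight k (multidegree a T)) Ψ T := by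
  rw [coeff_koszulD, koszulD_apply]
  refine Finset.sum_congr rfl fun v hv => ?_
  by_cases hva : v ∈ a.support
  · have := Finsupp.mem_support_iff.1 hva
    rw [if_pos hva, h v hv hva, degreeWeight, if_pos, one_smul]
    rw [multidegree, if_pos hv]; lia
  · rw [if_neg hva, degreeWeight, if_neg, zero_smul]
    rw [Finsupp.notMem_support_iff] at hva
    rw [multidegree, if_pos hv, hva]; lia

lemma koszulExactAt_of_restrictionsExact [Fintype V] {n i : ℕ} (hi : i < n) {Δ : Complex V}
    (hΔ : RestrictionsExact k n Δ Finset.univ) :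
    KoszulExactAt (MvPolynomial.X : V → MvPolynomial V k) (StanleyReisnerRing k Δ) i := by
  classical
  intro f hf
  obtain ⟨p, rfl⟩ := exists_lift f
  have hloc := fun b => koszulD_exact_of_degree hi hΔ b
    (fun T => (p T).coeff (exponentAt b T)) fun T hT hadm hs => by
      have := koszulD_mk_eq_zero_iff.1 (hf T hT) _ hs
      rwa [coeff_koszulD_eq p (fun T => (p T).coeff (exponentAt b T)), multidegree_exponentAt hadm]
        at this
      intro v hv hva
      rw [← exponentAt_multidegree (exponentAt b T - _) (T.erase v), multidegree_sub_single hv hva,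
        multidegree_exponentAt hadm]
  choose Ψ hΨ using hloc
  -- Only the finitely many multidegrees occurring in `p` receive a primitive; the others receive 0,
  -- so that the sum is a polynomial.
  let B : Finset (V → ℤ) :=
    Finset.univ.biUnion fun T : Finset V => (p T).support.image fun a => multidegree a T
  let q : Finset V → MvPolynomial V k := fun T =>
    ∑ b ∈ B, if Admissible b T then MvPolynomial.monomial (exponentAt b T) (Ψ b T) else 0
  have hq : ∀ T a, (q T).coeff a =
      if multidegree a T ∈ B then Ψ (multidegree a T) T else 0 := by
    intro T a
    simp only [q]
    rw [MvPolynomial.coeff_sum, ← Finset.sum_ite_eq' B (multidegree a T) (fun b => Ψ b T)]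
    refine Finset.sum_congr rfl fun b _ => ?_
    by_cases hb : b = multidegree a T
    · subst hb
      rw [if_pos (admissible_multidegree a T), if_pos rfl, exponentAt_multidegree,
        MvPolynomial.coeff_monomial, if_pos rfl]
    · rw [if_neg hb]
      split_ifs with hadm
      · rw [MvPolynomial.coeff_monomial, if_neg]
        rintro rfl
        exact hb (multidegree_exponentAt hadm).symm
      · simp
  refine ⟨fun T => Ideal.Quotient.mk _ (q T), fun T hT => ?_⟩
  rw [koszulD_mk_eq_mk_iff]
  intro a ha
  rw [coeff_koszulD_eq q (if multidegree a T ∈ B then Ψ (multidegree a T) else 0)]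
  · split_ifs with hB
    · rw [hΨ _ T hT (admissible_multidegree a T) (by rwa [exponentAt_multidegree]),
        exponentAt_multidegree]
    · rw [map_zero, Pi.zero_apply, eq_comm, ← MvPolynomial.notMem_support_iff]
      exact fun h => hB (Finset.mem_biUnion.2
        ⟨T, Finset.mem_univ _, Finset.mem_image.2 ⟨a, h, rfl⟩⟩)
  · intro v hv hva
    rw [hq, multidegree_sub_single hv hva]
    split_ifs <;> rfl

/-- Hochster's description of depth: the depth of `k[Δ]` is at least `n` if and only if the
restrictions of `Δ` have no cohomology in low degrees. -/
theorem exists_isWeaklyRegular_iff_restrictionsExact [Fintype V] (Δ : Complex V) (n : ℕ) :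
    (∃ rs : List (MvPolynomial V k),
      (∀ r ∈ rs, r ∈ Ideal.span (Set.range (MvPolynomial.X : V → MvPolynomial V k))) ∧
      RingTheory.Sequence.IsWeaklyRegular (StanleyReisnerRing k Δ) rs ∧ rs.length = n) ↔
    RestrictionsExact k n Δ Finset.univ := by
  rw [exists_isWeaklyRegular_iff]
  exact ⟨fun h W _ j hj => exactAt_of_koszulExactAt (h _ hj),
    fun h i hi => koszulExactAt_of_restrictionsExact hi h⟩

end Hochster

/-! ### Links, Mayer–Vietoris and deletion of an interval of faces. -/

section Cohomology

variable {k : Type*} [Field k] {V : Type*} [LinearOrder V]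

lemma RestrictionsExact.mono {m n : ℕ} {Δ : Complex V} {P : Finset V}
    (h : RestrictionsExact k n Δ P) (hmn : m ≤ n) : RestrictionsExact k m Δ P :=
  fun W hW j hj => h W hW j (hj.trans_le hmn)

/-- The complex of all `T` such that `T ∪ Y` is a face of `Δ`; its restriction to the complement of
`Y` is the link of `Y`. -/
def star (Δ : Complex V) (Y : Finset V) : Complex V where
  carrier := {T | T ∪ Y ∈ Δ}
  lower' _ _ h ha := Δ.lower (Finset.union_subset_union_left h) ha

lemma mem_star {Δ : Complex V} {Y T : Finset V} : T ∈ star Δ Y ↔ T ∪ Y ∈ Δ := Iff.rfl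

lemma star_le (Δ : Complex V) (Y : Finset V) : star Δ Y ≤ Δ :=
  fun _ h => Δ.lower Finset.subset_union_left h

lemma mem_star_singleton {Δ : Complex V} {y : V} {T : Finset V} :
    T ∈ star Δ {y} ↔ insert y T ∈ Δ := by
  rw [mem_star, Finset.union_comm, ← Finset.insert_eq]

lemma star_empty (Δ : Complex V) : star Δ ∅ = Δ := by
  ext T; simp [mem_star]

lemma star_insert (Δ : Complex V) (y : V) (Y : Finset V) :
    star Δ (insert y Y) = star (star Δ {y}) Y := by
  ext T
  change T ∈ star _ _ ↔ T ∈ star _ _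
  rw [mem_star, mem_star, mem_star_singleton, Finset.union_insert]

lemma IsCocycle.mono {Δ Γ : Complex V} {W : Finset V} {j : ℕ} {φ : Finset V → k}
    (h : IsCocycle Γ W j φ) (hle : Δ ≤ Γ) : IsCocycle Δ W j φ :=
  fun T hT => h T (hle hT)

lemma koszulD_insert (φ : Finset V → k) {y : V} {T : Finset V} (hy : y ∉ T) :
    koszulD (1 : V → k) φ (insert y T) =
      sgn y T • (φ T - koszulD (1 : V → k) (contraction y φ) T) := by
  have := koszulD_contraction (1 : V → k) y φ T
  rw [contraction, if_neg hy, Pi.one_apply, one_smul] at this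
  rw [← this, add_sub_cancel_left, smul_smul, sgn_mul_self, one_smul]

/-- In the sequence of the pair (Δ|_(W ∪ y), Δ|_W), the relative cohomology is that of the link of
y, shifted by one. Both neighbouring terms vanish in the relevant degrees. -/
lemma RestrictionsExact.star_singleton {n : ℕ} {Δ : Complex V} {P : Finset V}
    (h : RestrictionsExact k (n + 1) Δ P) {y : V} (hy : y ∈ P) :
    RestrictionsExact k n (star Δ {y}) (P.erase y) := by
  intro W hW j hj φ hφ
  have hyW : y ∉ W := fun h => by simpa using hW h
  have hyT : ∀ {T}, T ⊆ W → y ∉ T := fun hT h => hyW (hT h)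
  have hWP : W ⊆ P := hW.trans (Finset.erase_subset _ _)
  have e1 : P \ insert y W = P.erase y \ W := by
    ext v; simp only [Finset.mem_sdiff, Finset.mem_insert, Finset.mem_erase]; tauto
  have e2 : P \ W = insert y (P.erase y \ W) := by
    ext v
    simp only [Finset.mem_sdiff, Finset.mem_insert, Finset.mem_erase]
    by_cases hv : v = y
    · subst hv; simp [hy, hyW]
    · simp [hv]
  let Φ : Finset V → k := fun T => if y ∈ T then sgn y (T.erase y) • φ (T.erase y) else 0
  have hcontr : ∀ {T}, y ∉ T → contraction y Φ T = φ T := fun {T} hT => by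
    simp only [contraction, Φ]
    rw [if_neg hT, if_pos (Finset.mem_insert_self _ _), Finset.erase_insert hT, smul_smul,
      sgn_mul_self, one_smul]
  have hΦ0 : ∀ {T}, y ∉ T → Φ T = 0 := fun hT => if_neg hT
  obtain ⟨η, hη⟩ := h (insert y W) (Finset.insert_subset hy hWP) (j + 1) (by rw [e1]; lia) Φ
    fun T hT hTW hTc => by
      by_cases hyT' : y ∈ T
      · obtain ⟨S, hS, rfl⟩ : ∃ S, y ∉ S ∧ insert y S = T :=
          ⟨T.erase y, by simp, Finset.insert_erase hyT'⟩
        rw [koszulD_insert _ hS, hΦ0 hS, zero_sub, koszulD_congr (g := φ), hφ S, neg_zero, smul_zero]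
        · exact mem_star_singleton.2 hT
        · exact (Finset.insert_subset_insert_iff hS).1 hTW
        · rw [Finset.card_insert_of_notMem hS] at hTc; lia
        · exact fun v _ => hcontr fun h => hS (Finset.mem_of_mem_erase h)
      · exact koszulD_eq_zero fun v _ => hΦ0 fun h => hyT' (Finset.mem_of_mem_erase h)
  obtain ⟨ξ, hξ⟩ := h W hWP j (by rw [e2, Finset.card_insert_of_notMem (by simp)]; lia) η
    fun T hT hTW hTc => by
      rw [hη T hT (hTW.trans (Finset.subset_insert _ _)) hTc, hΦ0 (hyT hTW)]
  refine ⟨ξ - contraction y η, fun T hT hTW hTc => ?_⟩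
  have h1 := hη (insert y T) (mem_star_singleton.1 hT) (Finset.insert_subset_insert y hTW)
    (by rw [Finset.card_insert_of_notMem (hyT hTW), hTc])
  have h2 := koszulD_contraction (1 : V → k) y η T
  rw [contraction, if_neg (hyT hTW), h1, Pi.one_apply, one_smul] at h2
  have h3 := hcontr (hyT hTW)
  rw [contraction, if_neg (hyT hTW)] at h3
  rw [map_sub, Pi.sub_apply, hξ T (star_le _ _ hT) hTW hTc, ← h2, h3, add_sub_cancel_left]

/-- If φ = dψ on the link of y, then φ - dψ extends by zero to a cocycle on W ∪ {y}, where exactness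
applies. -/
lemma IsCoboundary.of_star_singleton {Δ : Complex V} {W : Finset V} {y : V} (hy : y ∉ W) {j : ℕ}
    (hex : ExactAt k Δ (insert y W) j) {φ : Finset V → k} (hφ : IsCocycle Δ W j φ)
    (h : IsCoboundary (star Δ {y}) W j φ) : IsCoboundary Δ W j φ := by
  obtain ⟨ψ, hψ⟩ := h
  let χ : Finset V → k := fun T => if y ∈ T then 0 else (φ - koszulD (1 : V → k) ψ) T
  have hχ : contraction y χ = 0 := by
    ext T; simp [contraction, χ]
  obtain ⟨η, hη⟩ := hex χ fun T hT hTW hTc => by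
    by_cases hyT : y ∈ T
    · obtain ⟨S, hS, rfl⟩ : ∃ S, y ∉ S ∧ insert y S = T :=
        ⟨T.erase y, by simp, Finset.insert_erase hyT⟩
      rw [koszulD_insert _ hS, hχ, map_zero, Pi.zero_apply, sub_zero]
      simp only [χ]
      rw [if_neg hS, Pi.sub_apply, hψ S, sub_self, smul_zero]
      · exact mem_star_singleton.2 hT
      · exact (Finset.insert_subset_insert_iff hS).1 hTW
      · rw [Finset.card_insert_of_notMem hS] at hTc; lia
    · rw [koszulD_congr (g := φ - koszulD (1 : V → k) ψ), map_sub, Pi.sub_apply,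
        koszulD_koszulD_apply, sub_zero, hφ T hT ((Finset.subset_insert_iff_of_notMem hyT).1 hTW) hTc]
      exact fun v _ => if_neg fun h => hyT (Finset.mem_of_mem_erase h)
  refine ⟨η + ψ, fun T hT hTW hTc => ?_⟩
  rw [map_add, Pi.add_apply, hη T hT (hTW.trans (Finset.subset_insert _ _)) hTc]
  simp only [χ]
  rw [if_neg fun h => hy (hTW h), Pi.sub_apply, sub_add_cancel]

/-- The degree j = n - |Y| is the first one in which exactness on P∖Y is not given; restriction to
the link of `Y` is still injective on cohomology there. -/
lemma IsCoboundary.of_star (Y : Finset V) : ∀ {n : ℕ} {Δ : Complex V} {P : Finset V},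
    RestrictionsExact k n Δ P → Y ⊆ P → ∀ {j : ℕ}, j + Y.card = n → ∀ {φ : Finset V → k},
    IsCocycle Δ (P \ Y) j φ → IsCoboundary (star Δ Y) (P \ Y) j φ →
    IsCoboundary Δ (P \ Y) j φ := by
  induction Y using Finset.induction_on with
  | empty =>
    intro n Δ P _ _ j _ φ _ h
    rwa [star_empty] at h
  | insert y Y hyY ih =>
    intro n Δ P hΔ hYP j hj φ hφ h
    obtain ⟨hy, hY⟩ := Finset.insert_subset_iff.1 hYP
    rw [Finset.card_insert_of_notMem hyY] at hj
    obtain rfl : n = j + Y.card + 1 := by lia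
    refine IsCoboundary.of_star_singleton (y := y) (by simp) ?_ hφ ?_
    · refine hΔ _ (Finset.insert_subset hy Finset.sdiff_subset) j ?_
      have : P \ insert y (P \ insert y Y) ⊆ Y := by
        intro v
        simp only [Finset.mem_sdiff, Finset.mem_insert]
        tauto
      have := Finset.card_le_card this
      lia
    · have e : P \ insert y Y = P.erase y \ Y := by
        ext v; simp only [Finset.mem_sdiff, Finset.mem_insert, Finset.mem_erase]; tauto
      rw [star_insert] at h
      rw [e] at h hφ ⊢
      refine ih (hΔ.star_singleton hy) (fun v hv => Finset.mem_erase.2 ⟨?_, hY hv⟩) rfl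
        (hφ.mono (star_le _ _)) h
      rintro rfl
      exact hyY hv

/-- The link of a facet is {∅}, whose cohomology in degree 0 is nonzero. This bounds depth by
dimension and also gives purity. -/
lemma RestrictionsExact.le_card (F : Finset V) : ∀ {n : ℕ} {Δ : Complex V} {P : Finset V},
    RestrictionsExact k n Δ P → F ⊆ P → F ∈ Δ → (∀ T ∈ Δ, T ⊆ P → F ⊆ T → T = F) →
    n ≤ F.card := by
  induction F using Finset.induction_on with
  | empty =>
    intro n Δ P hΔ _ hF hmax
    by_contra! hn
    obtain ⟨ψ, hψ⟩ := hΔ P subset_rfl 0 (by simpa using hn) 1 fun T hT hTP hTc => by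
      rw [hmax T hT hTP (Finset.empty_subset _)] at hTc
      simp at hTc
    have := hψ ∅ hF (Finset.empty_subset _) rfl
    rw [koszulD_empty] at this
    exact zero_ne_one this
  | insert y F hyF ih =>
    intro n Δ P hΔ hFP hF hmax
    obtain ⟨hy, hFP'⟩ := Finset.insert_subset_iff.1 hFP
    rw [Finset.card_insert_of_notMem hyF]
    obtain _ | n := n
    · exact Nat.zero_le _
    refine Nat.succ_le_succ (ih (hΔ.star_singleton hy) (fun v hv => Finset.mem_erase.2 ⟨?_, hFP' hv⟩)
      (mem_star_singleton.2 hF) fun T hT hTP hFT => ?_)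
    · rintro rfl; exact hyF hv
    · have hyT : y ∉ T := fun h => by simpa using hTP h
      have := hmax _ (mem_star_singleton.1 hT)
        (Finset.insert_subset hy (hTP.trans (Finset.erase_subset _ _)))
        (Finset.insert_subset_insert _ hFT)
      rw [← Finset.erase_insert hyT, this, Finset.erase_insert hyF]

/-- Two primitives differ on the intersection by a cocycle one degree lower; writing it as a
coboundary dγ allows them to be glued. For j = 0 there is nothing to correct. -/
lemma IsCoboundary.sup {Δ Γ : Complex V} {W : Finset V} {j : ℕ} {φ : Finset V → k}
    (hI : ∀ i, i + 1 = j → ExactAt k (Δ ⊓ Γ) W i) (hΔ : IsCoboundary Δ W j φ)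
    (hΓ : IsCoboundary Γ W j φ) : IsCoboundary (Δ ⊔ Γ) W j φ := by
  classical
  obtain ⟨α, hα⟩ := hΔ
  obtain ⟨β, hβ⟩ := hΓ
  obtain ⟨γ, hγ⟩ : ∃ γ : Finset V → k, ∀ T ∈ Δ ⊓ Γ, T ⊆ W → T.card + 1 = j →
      koszulD (1 : V → k) γ T = α T - β T := by
    obtain _ | i := j
    · exact ⟨0, fun T _ _ h => absurd h (by lia)⟩
    · obtain ⟨γ, hγ⟩ := hI i rfl (α - β) fun T hT hTW hTc => by
        rw [map_sub, Pi.sub_apply, hα T hT.1 hTW hTc, hβ T hT.2 hTW hTc, sub_self]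
      exact ⟨γ, fun T hT hTW hTc => hγ T hT hTW (by lia)⟩
  refine ⟨fun T => if T ∈ Δ then α T else (β + koszulD (1 : V → k) γ) T,
    fun T hT hTW hTc => ?_⟩
  by_cases hTΔ : T ∈ Δ
  · rw [← hα T hTΔ hTW hTc]
    exact koszulD_congr fun v _ => if_pos (Δ.lower (Finset.erase_subset _ _) hTΔ)
  · have hTΓ : T ∈ Γ := (LowerSet.mem_sup_iff.1 hT).resolve_left hTΔ
    rw [← hβ T hTΓ hTW hTc, koszulD_congr (g := β + koszulD (1 : V → k) γ), map_add, Pi.add_apply,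
      koszulD_koszulD_apply, add_zero]
    intro v hv
    split_ifs with hv'
    · rw [Pi.add_apply, hγ _ ⟨hv', Γ.lower (Finset.erase_subset _ _) hTΓ⟩
        ((Finset.erase_subset _ _).trans hTW) (by rw [Finset.card_erase_add_one hv, hTc]),
        add_sub_cancel]
    · rfl

lemma RestrictionsExact.sup {n : ℕ} {Δ Γ : Complex V} {P : Finset V}
    (hΔ : RestrictionsExact k n Δ P) (hΓ : RestrictionsExact k n Γ P)
    (hI : RestrictionsExact k n (Δ ⊓ Γ) P) : RestrictionsExact k n (Δ ⊔ Γ) P :=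
  fun W hW j hj φ hφ => IsCoboundary.sup (fun i hi => hI W hW i (by lia))
    (hΔ W hW j hj φ (hφ.mono le_sup_left)) (hΓ W hW j hj φ (hφ.mono le_sup_right))

/-- A primitive of the indicator of `H` would be a cocycle on Δ', hence some dψ there. It would then
agree with dψ on the boundary of `H`, so its coboundary at `H` would be 0 instead of 1. -/
lemma not_isCoboundary_single {Δ Δ' : Complex V} {W H : Finset V} (hH : H ∈ Δ) (hHW : H ⊆ W)
    (hH' : ∀ T ∈ Δ, T ⊆ W → (T ∉ Δ' ↔ T = H)) (hex : ∀ i, i + 1 = H.card → ExactAt k Δ' W i)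
    (hle : Δ' ≤ Δ) : ¬ IsCoboundary Δ W H.card (Pi.single H (1 : k)) := by
  rintro ⟨φ, hφ⟩
  have hφH := hφ H hH hHW rfl
  rw [Pi.single_eq_same] at hφH
  obtain hc | ⟨i, hc⟩ : H.card = 0 ∨ ∃ i, H.card = i + 1 := by cases H.card <;> simp
  · rw [Finset.card_eq_zero] at hc
    subst hc
    rw [koszulD_empty] at hφH
    exact zero_ne_one hφH
  · obtain ⟨ψ, hψ⟩ := hex i hc.symm φ fun T hT hTW hTc => by
      rw [hφ T (hle hT) hTW (by rw [hTc, hc]), Pi.single_eq_of_ne]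
      rintro rfl
      exact (hH' T hH hHW).2 rfl hT
    suffices koszulD (1 : V → k) (φ - koszulD (1 : V → k) ψ) H = 0 by
      rw [map_sub, Pi.sub_apply, koszulD_koszulD_apply, sub_zero, hφH] at this
      exact one_ne_zero this
    refine koszulD_eq_zero fun v hv => ?_
    have hne : H.erase v ≠ H := fun h => Finset.notMem_erase v H (h.symm ▸ hv)
    have hW := (Finset.erase_subset v H).trans hHW
    have hmem : H.erase v ∈ Δ' := by
      by_contra h
      exact hne ((hH' _ (Δ.lower (Finset.erase_subset _ _) hH) hW).1 h)
    rw [Pi.sub_apply, hψ _ hmem hW (by rw [Finset.card_erase_of_mem hv, hc]; rfl), sub_self]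

/-- If no other face of that size contained (H ∪ Y)∖{v}, the signed indicator of H∖{v} would be a
primitive of the indicator of `H`. -/
lemma exists_ne_of_not_isCoboundary_single {Δ : Complex V} {W H Y : Finset V}
    (hYW : Disjoint Y W) (hHW : H ⊆ W)
    (h : ¬ IsCoboundary (star Δ Y) W H.card (Pi.single H (1 : k))) {v : V} (hv : v ∈ H) :
    ∃ T ∈ Δ, (H ∪ Y).erase v ⊆ T ∧ T ≠ H ∪ Y ∧ T.card = (H ∪ Y).card := by
  by_contra! hc
  refine h ⟨sgn v (H.erase v) • Pi.single (H.erase v) (1 : k), fun T hT hTW hTc => ?_⟩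
  have hdT : Disjoint T Y := (hYW.mono_right hTW).symm
  have hdH : Disjoint H Y := (hYW.mono_right hHW).symm
  by_cases hTH : T = H
  · subst hTH
    rw [Pi.single_eq_same, koszulD_apply, Finset.sum_eq_single v]
    · simp [← Int.cast_mul, sgn_mul_self]
    · intro u hu huv
      have : T.erase u ≠ T.erase v := fun h => by
        have := h ▸ Finset.mem_erase.2 ⟨huv.symm, hv⟩
        simp at this
      simp [this]
    · exact fun h => absurd hv h
  · rw [Pi.single_eq_of_ne hTH]
    refine koszulD_eq_zero fun u hu => ?_
    rw [Pi.smul_apply, Pi.single_eq_of_ne, smul_zero]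
    intro he
    refine hc (T ∪ Y) hT ?_ (fun h => hTH ?_) ?_
    · rw [Finset.erase_union_distrib, ← he]
      exact Finset.union_subset_union (Finset.erase_subset _ _) (Finset.erase_subset _ _)
    · rw [← Finset.union_sdiff_cancel_right hdT, h, Finset.union_sdiff_cancel_right hdH]
    · rw [Finset.card_union_of_disjoint hdT, Finset.card_union_of_disjoint hdH, hTc]

variable [Fintype V]

/-- The cochains of Δ relative to Δ' live on the interval [H, F]. Restricted to `W`, this relative
complex is acyclic if `W` meets F∖H, and otherwise is supported on `H` alone, where the hypothesis
on the class of `H` takes over. -/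
lemma RestrictionsExact.of_not_isCoboundary_single {Δ Δ' : Complex V} (hle : Δ' ≤ Δ)
    {F H : Finset V} (hF : F ∈ Δ) (hHF : H ⊆ F) (hΔ : RestrictionsExact k F.card Δ Finset.univ)
    (hmem : ∀ T ∈ Δ, T ∉ Δ' ↔ H ⊆ T ∧ T ⊆ F)
    (hH : ¬ IsCoboundary Δ (Finset.univ \ (F \ H)) H.card (Pi.single H (1 : k))) :
    RestrictionsExact k F.card Δ' Finset.univ := by
  classical
  intro W hW j hj φ hφ
  let φ' : Finset V → k := fun T => if T ∈ Δ' then φ T else 0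
  have hφ' : ∀ T ∈ Δ', koszulD (1 : V → k) φ' T = koszulD (1 : V → k) φ T := fun T hT =>
    koszulD_congr fun v _ => if_pos (Δ'.lower (Finset.erase_subset _ _) hT)
  -- Such a ρ corrects the extension by zero of φ to a cocycle on Δ without changing it on Δ'.
  suffices ∃ ρ : Finset V → k, (∀ T ∈ Δ', ρ T = 0) ∧
      ∀ T ∈ Δ, T ∉ Δ' → T ⊆ W → T.card = j + 1 →
        koszulD (1 : V → k) ρ T = koszulD (1 : V → k) φ' T by
    obtain ⟨ρ, hρ, hρ'⟩ := this
    obtain ⟨η, hη⟩ := hΔ W hW j hj (φ' - ρ) fun T hT hTW hTc => by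
      rw [map_sub, Pi.sub_apply]
      by_cases hT' : T ∈ Δ'
      · rw [hφ' T hT', hφ T hT' hTW hTc, zero_sub, neg_eq_zero]
        exact koszulD_eq_zero fun v _ => hρ _ (Δ'.lower (Finset.erase_subset _ _) hT')
      · rw [hρ' T hT hT' hTW hTc, sub_self]
    refine ⟨η, fun T hT hTW hTc => ?_⟩
    rw [hη T (hle hT) hTW hTc, Pi.sub_apply, hρ T hT, sub_zero]
    exact if_pos hT
  by_cases hu : ∃ u ∈ F, u ∈ W ∧ u ∉ H
  · obtain ⟨u, huF, huW, huH⟩ := hu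
    refine ⟨fun T => if T ∈ Δ' then 0 else contraction u (koszulD (1 : V → k) φ') T,
      fun T hT => if_pos hT, fun T hT hT' hTW hTc => ?_⟩
    rw [koszulD_congr (g := contraction u (koszulD (1 : V → k) φ'))]
    · have := koszulD_contraction (1 : V → k) u (koszulD (1 : V → k) φ') T
      rw [koszulD_koszulD] at this
      simpa [contraction] using this
    · intro v hv
      split_ifs with hTv
      · rw [contraction]
        split_ifs with huT
        · rfl
        obtain ⟨hHT, hTF⟩ := (hmem T hT).1 hT'
        have hvH : v ∈ H := by
          by_contra hvH
          refine (hmem _ (hle hTv)).2 ⟨fun w hw => Finset.mem_erase.2 ⟨?_, hHT hw⟩,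
            (Finset.erase_subset _ _).trans hTF⟩ hTv
          rintro rfl
          exact hvH hw
        -- This set misses v ∈ H, so it lies outside the interval [H, F].
        have huT' : insert u (T.erase v) ∈ Δ' := by
          have hins : insert u (T.erase v) ⊆ F :=
            Finset.insert_subset huF ((Finset.erase_subset _ _).trans hTF)
          by_contra hc
          have hv' := ((hmem _ (Δ.lower hins hF)).1 hc).1 hvH
          rw [Finset.mem_insert] at hv'
          rcases hv' with rfl | hv'
          · exact huH hvH
          · simp at hv'
        rw [hφ' _ huT', hφ _ huT' (Finset.insert_subset huW ((Finset.erase_subset _ _).trans hTW))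
          (by rw [Finset.card_insert_of_notMem huT, Finset.card_erase_add_one hv, hTc]), smul_zero]
      · rfl
  · push Not at hu
    refine ⟨0, fun _ _ => rfl, fun T hT hT' hTW hTc => ?_⟩
    rw [map_zero, Pi.zero_apply]
    have hTH : ∀ S ∈ Δ, S ∉ Δ' → S ⊆ W → S = H := fun S hS hS' hSW => by
      obtain ⟨h1, h2⟩ := (hmem S hS).1 hS'
      exact Finset.Subset.antisymm (fun v hv => hu v (h2 hv) (hSW hv)) h1
    obtain rfl := hTH T hT hT' hTW
    by_contra! hc
    -- Now F∖H lies in the complement of `W`, and the bound on j leaves room for nothing else.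
    have hW' : Finset.univ \ (F \ T) = W := by
      have hsub : F \ T ⊆ Finset.univ \ W := fun v hv => by
        rw [Finset.mem_sdiff] at hv ⊢
        exact ⟨Finset.mem_univ v, fun h => hv.2 (hu v hv.1 h)⟩
      rw [Finset.eq_of_subset_of_card_le hsub, sdiff_sdiff_right_self, Finset.inf_eq_inter,
        Finset.univ_inter]
      rw [Finset.card_sdiff_of_subset hHF]
      lia
    rw [hW', hTc] at hH
    refine hH ⟨(koszulD (1 : V → k) φ' T)⁻¹ • φ', fun S hS hSW hSc => ?_⟩
    rw [map_smul, Pi.smul_apply, smul_eq_mul]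
    by_cases hST : S = T
    · subst hST
      rw [Pi.single_eq_same, inv_mul_cancel₀ hc.symm]
    · have hS' : S ∈ Δ' := by
        by_contra h
        exact hST (hTH S hS h hSW)
      rw [Pi.single_eq_of_ne hST, hφ' S hS', hφ S hS' hSW hSc, mul_zero]

end Cohomology

/-! ### Removing facets, and minimality of the union. -/

section Main

variable {V : Type*}

lemma isFacet_of_card {Δ : Complex V} {d : ℕ} (hd : ∀ F ∈ Δ, F.card ≤ d) {F : Finset V}
    (hF : F ∈ Δ) (hFd : F.card = d) : IsFacet Δ F :=
  ⟨hF, fun G hG hFG => (Finset.eq_of_subset_of_card_le hFG (by rw [hFd]; exact hd G hG)).ge⟩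

lemma mem_removeFacet {Δ : Complex V} {F G : Finset V} :
    G ∈ removeFacet Δ F ↔ ∃ T, IsFacet Δ T ∧ T ≠ F ∧ G ⊆ T := by
  simp [removeFacet, mem_lowerClosure, and_assoc]

lemma removeFacet_le (Δ : Complex V) (F : Finset V) : removeFacet Δ F ≤ Δ := fun _ hG => by
  obtain ⟨T, hT, -, hGT⟩ := mem_removeFacet.1 hG
  exact Δ.lower hGT hT.prop

lemma notMem_removeFacet {Δ : Complex V} {F : Finset V} (hF : IsFacet Δ F) :
    F ∉ removeFacet Δ F := fun h => by
  obtain ⟨T, hT, hTF, hFT⟩ := mem_removeFacet.1 h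
  exact hTF (hFT.antisymm (hF.le_of_ge hT.prop hFT)).symm

variable [Fintype V]

lemma dim_eq_iff {Δ : Complex V} {d : ℕ} :
    dim Δ = (((d : ℤ) - 1 : ℤ) : WithBot ℤ) ↔
      (∃ F ∈ Δ, F.card = d) ∧ ∀ F ∈ Δ, F.card ≤ d := by
  classical
  have hcast : ∀ m : ℕ, (((m : ℤ) - 1 : ℤ) : WithBot ℤ) ≤ (((d : ℤ) - 1 : ℤ) : WithBot ℤ) ↔ m ≤ d :=
    fun m => by rw [WithBot.coe_le_coe]; lia
  constructor
  · intro h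
    have hle : ∀ F ∈ Δ, F.card ≤ d := fun F hF => by
      rw [← hcast, ← h]
      exact Finset.le_sup (f := fun F : Finset V => (((F.card : ℤ) - 1 : ℤ) : WithBot ℤ))
        (by simpa using hF)
    refine ⟨?_, hle⟩
    have hne : (Finset.univ.filter (fun F : Finset V => F ∈ Δ)).Nonempty := by
      by_contra hc
      rw [Finset.not_nonempty_iff_eq_empty] at hc
      rw [dim, hc, Finset.sup_empty] at h
      exact WithBot.bot_ne_coe h
    obtain ⟨F, hF, hF'⟩ := Finset.exists_mem_eq_sup _ hne
      (fun F : Finset V => (((F.card : ℤ) - 1 : ℤ) : WithBot ℤ))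
    refine ⟨F, by simpa using hF, ?_⟩
    have h2 : (((F.card : ℤ) - 1 : ℤ) : WithBot ℤ) = (((d : ℤ) - 1 : ℤ) : WithBot ℤ) := by
      rw [← h, ← hF', dim]
    rw [WithBot.coe_inj] at h2
    lia
  · rintro ⟨⟨F, hF, hFd⟩, hle⟩
    apply le_antisymm
    · refine Finset.sup_le fun G hG => (hcast _).2 (hle G ?_)
      simpa using hG
    · rw [← hFd]
      exact Finset.le_sup (f := fun F : Finset V => (((F.card : ℤ) - 1 : ℤ) : WithBot ℤ))
        (by simpa using hF)

lemma exists_isFacet_ge {Δ : Complex V} {G : Finset V} (hG : G ∈ Δ) :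
    ∃ F, IsFacet Δ F ∧ G ⊆ F := by
  obtain ⟨F, hGF, hF⟩ := (Set.toFinite {F | F ∈ Δ}).exists_le_maximal hG
  exact ⟨F, hF, hGF⟩

lemma subset_of_notMem_removeFacet {Δ : Complex V} {F G : Finset V} (hG : G ∈ Δ)
    (hG' : G ∉ removeFacet Δ F) : G ⊆ F := by
  obtain ⟨T, hT, hGT⟩ := exists_isFacet_ge hG
  by_cases h : T = F
  · rwa [← h]
  · exact absurd (mem_removeFacet.2 ⟨T, hT, h, hGT⟩) hG'

variable {k : Type*} [Field k] [LinearOrder V]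

lemma RestrictionsExact.le_card_of_isFacet {n : ℕ} {Δ : Complex V}
    (h : RestrictionsExact k n Δ Finset.univ) {F : Finset V} (hF : IsFacet Δ F) : n ≤ F.card :=
  h.le_card F (Finset.subset_univ F) hF.prop fun _ hT _ hFT =>
    (hFT.antisymm (hF.le_of_ge hT hFT)).symm

lemma isCM_iff {Δ : Complex V} {d : ℕ} (hd : dim Δ = (((d : ℤ) - 1 : ℤ) : WithBot ℤ)) :
    IsCM k Δ ↔ RestrictionsExact k d Δ Finset.univ := by
  obtain ⟨⟨F, hF, hFd⟩, hle⟩ := dim_eq_iff.1 hd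
  constructor
  · rintro (rfl | ⟨e, he, hdepth⟩)
    · exact absurd hF (by simp)
    obtain rfl : e = d := by
      rw [hd, WithBot.coe_inj] at he; lia
    obtain _ | e := e
    · exact fun W _ j hj => absurd hj (by lia)
    · have hlt : (e : ℕ∞) < depth k Δ := by
        rw [hdepth]; exact_mod_cast Nat.lt_succ_self e
      obtain ⟨n, ⟨rs, h1, h2, rfl⟩, hn⟩ := lt_sSup_iff.1 hlt
      exact ((exists_isWeaklyRegular_iff_restrictionsExact Δ rs.length).1 ⟨rs, h1, h2, rfl⟩).mono
        (by exact_mod_cast hn)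
  · intro h
    refine Or.inr ⟨d, hd, le_antisymm (sSup_le ?_) (le_sSup ?_)⟩
    · rintro _ ⟨rs, h1, h2, rfl⟩
      have := ((exists_isWeaklyRegular_iff_restrictionsExact Δ rs.length).1
        ⟨rs, h1, h2, rfl⟩).le_card_of_isFacet (isFacet_of_card hle hF hFd)
      rw [hFd] at this
      exact_mod_cast this
    · obtain ⟨rs, h1, h2, h3⟩ := (exists_isWeaklyRegular_iff_restrictionsExact Δ d).2 h
      exact ⟨rs, h1, h2, by rw [h3]⟩

lemma card_of_isFacet {Δ : Complex V} {d : ℕ}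
    (hd : dim Δ = (((d : ℤ) - 1 : ℤ) : WithBot ℤ)) (hΔ : RestrictionsExact k d Δ Finset.univ)
    {F : Finset V} (hF : IsFacet Δ F) : F.card = d :=
  le_antisymm ((dim_eq_iff.1 hd).2 F hF.prop) (hΔ.le_card_of_isFacet hF)

/-- By purity the remaining facets still have d elements, so the dimension does not drop unless the
complex becomes void. -/
lemma isCM_removeFacet_iff {Δ : Complex V} {d : ℕ}
    (hd : dim Δ = (((d : ℤ) - 1 : ℤ) : WithBot ℤ)) (hΔ : RestrictionsExact k d Δ Finset.univ)
    (F : Finset V) :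
    IsCM k (removeFacet Δ F) ↔ RestrictionsExact k d (removeFacet Δ F) Finset.univ := by
  by_cases hbot : removeFacet Δ F = ⊥
  · refine ⟨fun _ => ?_, fun _ => Or.inl hbot⟩
    rw [hbot]
    exact fun W _ j _ φ _ => ⟨0, fun T hT => absurd hT (by simp)⟩
  · refine isCM_iff (dim_eq_iff.2 ⟨?_, fun G hG =>
      (dim_eq_iff.1 hd).2 G (removeFacet_le Δ F hG)⟩)
    obtain ⟨G, hG⟩ : ∃ G, G ∈ removeFacet Δ F := by
      by_contra! hc
      exact hbot (le_bot_iff.1 fun G hG => absurd hG (hc G))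
    obtain ⟨T, hT, hTF, -⟩ := mem_removeFacet.1 hG
    exact ⟨T, mem_removeFacet.2 ⟨T, hT, hTF, subset_rfl⟩, card_of_isFacet hd hΔ hT⟩

/-- If the cochain of a minimal new face `H` of the facet `F` of `Θ` does not become a coboundary
on the subcomplex `Δ`, then removing `F` from `Δ` preserves the Cohen-Macaulay property. -/
lemma exists_isCM_removeFacet {Θ Δ : Complex V} {d : ℕ} (hle : Δ ≤ Θ)
    (hΘ : ∀ F ∈ Θ, F.card ≤ d) (hd : dim Δ = (((d : ℤ) - 1 : ℤ) : WithBot ℤ))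
    (hΔ : RestrictionsExact k d Δ Finset.univ) {F H : Finset V} (hFd : F.card = d)
    (hHF : H ⊆ F) (hH : H ∉ removeFacet Θ F)
    (hW : ∀ T ∈ Θ, T ⊆ Finset.univ \ (F \ H) → T ∉ removeFacet Θ F → T = H)
    (hcob : ¬ IsCoboundary Δ (Finset.univ \ (F \ H)) H.card (Pi.single H (1 : k))) :
    IsFacet Δ F ∧ IsCM k (removeFacet Δ F) := by
  have hHWs : H ⊆ Finset.univ \ (F \ H) := fun v hv => by simp [hv]
  have hFH : H ∪ F \ H = F := Finset.union_sdiff_of_subset hHF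
  have huniq : ∀ T, IsFacet Δ T → H ⊆ T → T = F := fun T hT hHT => by
    by_contra hTF
    exact hH (mem_removeFacet.2
      ⟨T, isFacet_of_card hΘ (hle hT.prop) (card_of_isFacet hd hΔ hT), hTF, hHT⟩)
  have hHΔ : H ∈ Δ := by
    by_contra hc
    refine hcob ⟨0, fun T hT _ _ => ?_⟩
    rw [map_zero, Pi.zero_apply, Pi.single_eq_of_ne]
    rintro rfl
    exact hc hT
  have hF : IsFacet Δ F := by
    obtain ⟨T, hT, hHT⟩ := exists_isFacet_ge hHΔ
    rwa [← huniq T hT hHT]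
  have hcoc : IsCocycle Δ (Finset.univ \ (F \ H)) H.card (Pi.single H (1 : k)) := by
    intro T hT hTW hTc
    refine koszulD_eq_zero fun v hv => Pi.single_eq_of_ne ?_ _
    intro he
    have hHT : H ⊆ T := he ▸ Finset.erase_subset v T
    rw [hW T (hle hT) hTW fun h => hH ((removeFacet Θ F).lower hHT h)] at hTc
    lia
  have hstar : ¬ IsCoboundary (star Δ (F \ H)) (Finset.univ \ (F \ H)) H.card
      (Pi.single H (1 : k)) := fun h =>
    hcob (IsCoboundary.of_star (F \ H) hΔ (Finset.subset_univ _)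
      (by rw [Finset.card_sdiff_of_subset hHF, ← hFd]
          have := Finset.card_le_card hHF
          lia) hcoc h)
  -- In the link of F∖H the indicator of `H` is still not a coboundary, so each F∖{v} lies in a
  -- second facet.
  have herase : ∀ v ∈ H, F.erase v ∈ removeFacet Δ F := fun v hv => by
    obtain ⟨T, hT, hsub, hne, hcard⟩ :=
      exists_ne_of_not_isCoboundary_single Finset.disjoint_sdiff hHWs hstar hv
    rw [hFH] at hsub hne hcard
    exact mem_removeFacet.2
      ⟨T, isFacet_of_card (dim_eq_iff.1 hd).2 hT (hcard.trans hFd), hne, hsub⟩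
  have hHΔF : H ∉ removeFacet Δ F := fun h => by
    obtain ⟨T, hT, hTF, hHT⟩ := mem_removeFacet.1 h
    exact hTF (huniq T hT hHT)
  refine ⟨hF, (isCM_removeFacet_iff hd hΔ F).2 ?_⟩
  rw [← hFd] at hΔ ⊢
  refine hΔ.of_not_isCoboundary_single (removeFacet_le Δ F) hF.prop hHF (fun T hT => ⟨fun hT' => ?_,
    fun h hT' => hHΔF ((removeFacet Δ F).lower h.1 hT')⟩) hcob
  have hTF := subset_of_notMem_removeFacet hT hT'
  refine ⟨fun v hv => ?_, hTF⟩
  by_contra hvT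
  exact hT' ((removeFacet Δ F).lower (Finset.subset_erase.2 ⟨hTF, hvT⟩) (herase v hv))

theorem IsMinimalCM.sup {d : ℕ} {Δ Γ : Complex V} (hΔ : IsMinimalCM k Δ)
    (hΔd : dim Δ = (((d : ℤ) - 1 : ℤ) : WithBot ℤ)) (hΓ : IsMinimalCM k Γ)
    (hΓd : dim Γ = (((d : ℤ) - 1 : ℤ) : WithBot ℤ)) (hI : IsCM k (Δ ⊓ Γ))
    (hId : dim (Δ ⊓ Γ) = (((d : ℤ) - 1 : ℤ) : WithBot ℤ)) : IsMinimalCM k (Δ ⊔ Γ) := by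
  have hΔe := (isCM_iff hΔd).1 hΔ.1
  have hΓe := (isCM_iff hΓd).1 hΓ.1
  have hIe := (isCM_iff hId).1 hI
  have hUe := hΔe.sup hΓe hIe
  obtain ⟨⟨E, hE, hEd⟩, hΔle⟩ := dim_eq_iff.1 hΔd
  have hUle : ∀ F ∈ Δ ⊔ Γ, F.card ≤ d := fun F hF =>
    (LowerSet.mem_sup_iff.1 hF).elim (hΔle F) ((dim_eq_iff.1 hΓd).2 F)
  have hUd : dim (Δ ⊔ Γ) = (((d : ℤ) - 1 : ℤ) : WithBot ℤ) :=
    dim_eq_iff.2 ⟨⟨E, LowerSet.mem_sup_iff.2 (Or.inl hE), hEd⟩, hUle⟩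
  refine ⟨(isCM_iff hUd).2 hUe, fun F hF hCM => ?_⟩
  have hFd := card_of_isFacet hUd hUe hF
  rw [isCM_removeFacet_iff hUd hUe] at hCM
  obtain ⟨H, hHF, hHmin⟩ := (Set.toFinite {H | H ∉ removeFacet (Δ ⊔ Γ) F}).exists_le_minimal
    (notMem_removeFacet hF)
  have hH : H ∉ removeFacet (Δ ⊔ Γ) F := hHmin.prop
  have hHU : H ∈ Δ ⊔ Γ := (Δ ⊔ Γ).lower hHF hF.prop
  have hW : ∀ T ∈ Δ ⊔ Γ, T ⊆ Finset.univ \ (F \ H) → T ∉ removeFacet (Δ ⊔ Γ) F → T = H := by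
    intro T hT hTW hT'
    have hTF := subset_of_notMem_removeFacet hT hT'
    have hTH : T ⊆ H := fun v hv => by
      have := hTW hv
      simp only [Finset.mem_sdiff, Finset.mem_univ, true_and, not_and, not_not] at this
      exact this (hTF hv)
    exact hTH.antisymm (hHmin.le_of_le hT' hTH)
  -- Degree |H| is the first outside the range of vanishing on this restriction, and |H| - 1 is the
  -- last inside it.
  have hcard : (Finset.univ \ (Finset.univ \ (F \ H))).card + H.card = d := by
    rw [sdiff_sdiff_right_self, Finset.inf_eq_inter, Finset.univ_inter,
      Finset.card_sdiff_add_card_eq_card hHF, hFd]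
  have hcob := not_isCoboundary_single (k := k) (Δ' := removeFacet (Δ ⊔ Γ) F)
    (W := Finset.univ \ (F \ H)) hHU (fun v hv => by simp [hv])
    (fun T hT hTW => ⟨hW T hT hTW, fun h => h ▸ hH⟩)
    (fun i hi => hCM _ (Finset.subset_univ _) i (by lia)) (removeFacet_le _ _)
  by_cases hcΔ : IsCoboundary Δ (Finset.univ \ (F \ H)) H.card (Pi.single H (1 : k))
  · have hcΓ : ¬ IsCoboundary Γ (Finset.univ \ (F \ H)) H.card (Pi.single H (1 : k)) := fun h =>
      hcob (IsCoboundary.sup (fun i hi => hIe _ (Finset.subset_univ _) i (by lia)) hcΔ h)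
    obtain ⟨h1, h2⟩ := exists_isCM_removeFacet le_sup_right hUle hΓd hΓe hFd hHF hH hW hcΓ
    exact hΓ.2 F h1 h2
  · obtain ⟨h1, h2⟩ := exists_isCM_removeFacet le_sup_left hUle hΔd hΔe hFd hHF hH hW hcΔ
    exact hΔ.2 F h1 h2

end Main

end MinimalCM

theorem proposition4p3 {k : Type*} [Field k] {V : Type*} [Fintype V]
    (d : ℕ) (Δ Γ : MinimalCM.Complex V)
    (hΔ : MinimalCM.IsMinimalCM k Δ)
    (hΔd : MinimalCM.dim Δ = (((d : ℤ) - 1 : ℤ) : WithBot ℤ))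
    (hΓ : MinimalCM.IsMinimalCM k Γ)
    (hΓd : MinimalCM.dim Γ = (((d : ℤ) - 1 : ℤ) : WithBot ℤ))
    (hI : MinimalCM.IsStronglyCM k (Δ ⊓ Γ))
    (hId : MinimalCM.dim (Δ ⊓ Γ) = (((d : ℤ) - 1 : ℤ) : WithBot ℤ)) :
    MinimalCM.IsMinimalCM k (Δ ⊔ Γ) := by
  -- The order only fixes the signs of the differentials; any choice works.
  let _ : LinearOrder V := LinearOrder.lift' (Fintype.equivFin V) (Fintype.equivFin V).injective
  exact hΔ.sup hΔd hΓ hΓd hI.1 hId
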